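/- Let $\mathcal{L}_{\Box\Diamond}$ be the set of formulas built from an arbitrary set $Var$ of propositional variables with $\bot,\wedge,\vee,\to,\Box,\Diamond$, and write $\neg\varphi:=\varphi\to\bot$. A theory is a set of formulas. Let $\mathcal{G}_{\Box\Diamond}$ be the calculus whose axioms are all instances of the schemes of the Heyting (intuitionistic) propositional calculus, the prelinearity scheme $(\varphi\to\psi)\vee(\psi\to\varphi)$, and the schemes $$\Box(\varphi\to\psi)\to(\Box\varphi\to\Box\psi),\qquad \Diamond(\varphi\vee\psi)\to(\Diamond\varphi\vee\Diamond\psi),\qquad \neg\Diamond\bot,$$ $$\Diamond(\varphi\to\psi)\to(\Box\varphi\to\Diamond\psi),\qquad (\Diamond\varphi\to\Box\psi)\to\Box(\varphi\to\psi),$$ and whose rules are modus ponens, "from $\varphi$ infer $\Box\varphi$" and "from $\varphi\to\psi$ infer $\Diamond\varphi\to\Diamond\psi$". Write $T\vdash_{\mathcal{G}_{\Box\Diamond}}\varphi$ if $\varphi$ has a proof in this calculus from assumptions in $T$, where the last two rules may be applied only when their premise is a theorem, i.e. is provable without assumptions. A $GK$-model is a triple $M=\langle W,S,e\rangle$ with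 $W$ a non-empty set, and $S:W\times W\to[0,1]$ and $e:W\times Var\to[0,1]$ arbitrary functions. The function $e$ is extended to all formulas by $e(x,\bot)=0$, $e(x,\varphi\wedge\psi)=\min\{e(x,\varphi),e(x,\psi)\}$, $e(x,\varphi\vee\psi)=\max\{e(x,\varphi),e(x,\psi)\}$, $e(x,\varphi\to\psi)=e(x,\varphi)\Rightarrow e(x,\psi)$, $$e(x,\Box\varphi)=\inf_{y\in W}\bigl(S(x,y)\Rightarrow e(y,\varphi)\bigr),\qquad e(x,\Diamond\varphi)=\sup_{y\in W}\min\{S(x,y),e(y,\varphi)\},$$ where $a\Rightarrow b$ equals $1$ if $a\le b$ and equals $b$ otherwise. Write $T\models_{GK}\varphi$ if for every $GK$-model $M=\langle W,S,e\rangle$ and every $x\in W$: if $e(x,\theta)=1$ for all $\theta\in T$, then $e(x,\varphi)=1$. **Theorem (strong completeness).** For every countable theory $T\subseteq\mathcal{L}_{\Box\Diamond}$ and every formula $\varphi\in\mathcal{L}_{\Box\Diamond}$, $$T\vdash_{\mathcal{G}_{\Box\Diamond}}\varphi\quad\text{if and only if}\quad T\models_{GK}\varphi .$$ -/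

import Mathlib

universe u v

namespace BiModalGoedel

/-- Formulas of the bi-modal propositional language over the set `Var` of variables. -/
inductive Formula (Var : Type u) : Type u
  | var (p : Var) : Formula Var
  | bot : Formula Var
  | and (φ ψ : Formula Var) : Formula Var
  | or (φ ψ : Formula Var) : Formula Var
  | imp (φ ψ : Formula Var) : Formula Var
  | box (φ : Formula Var) : Formula Var
  | dia (φ : Formula Var) : Formula Var

/-- Negation is the usual abbreviation `φ → ⊥`. -/
def Formula.neg {Var : Type u} (φ : Formula Var) : Formula Var :=
  .imp φ .bot

open Formula

/-- Axioms of the Gödel–Dummett propositional calculus (Heyting calculus plus prelinearity),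
as schemes over all bi-modal formulas. -/
inductive GoedelAxiom {Var : Type u} : Formula Var → Prop
  | k (φ ψ : Formula Var) : GoedelAxiom (imp φ (imp ψ φ))
  | s (φ ψ χ : Formula Var) :
      GoedelAxiom (imp (imp φ (imp ψ χ)) (imp (imp φ ψ) (imp φ χ)))
  | andLeft (φ ψ : Formula Var) : GoedelAxiom (imp (and φ ψ) φ)
  | andRight (φ ψ : Formula Var) : GoedelAxiom (imp (and φ ψ) ψ)
  | andIntro (φ ψ : Formula Var) : GoedelAxiom (imp φ (imp ψ (and φ ψ)))
  | orLeft (φ ψ : Formula Var) : GoedelAxiom (imp φ (or φ ψ))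
  | orRight (φ ψ : Formula Var) : GoedelAxiom (imp ψ (or φ ψ))
  | orElim (φ ψ χ : Formula Var) :
      GoedelAxiom (imp (imp φ χ) (imp (imp ψ χ) (imp (or φ ψ) χ)))
  | exFalso (φ : Formula Var) : GoedelAxiom (imp bot φ)
  | prelinearity (φ ψ : Formula Var) : GoedelAxiom (or (imp φ ψ) (imp ψ φ))

/-- The modal axiom schemes: K□, K◇, F◇ and the two Fischer Servi connecting axioms. -/
inductive ModalAxiom {Var : Type u} : Formula Var → Prop
  | kBox (φ ψ : Formula Var) :
      ModalAxiom (imp (box (imp φ ψ)) (imp (box φ) (box ψ)))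
  | kDia (φ ψ : Formula Var) :
      ModalAxiom (imp (dia (or φ ψ)) (or (dia φ) (dia ψ)))
  | fDia : ModalAxiom (neg (dia bot))
  | fs1 (φ ψ : Formula Var) :
      ModalAxiom (imp (dia (imp φ ψ)) (imp (box φ) (dia ψ)))
  | fs2 (φ ψ : Formula Var) :
      ModalAxiom (imp (imp (dia φ) (box ψ)) (box (imp φ ψ)))

/-- `Derives T φ`: the formula `φ` is deducible from the assumptions `T` in the calculus G□◇.
The modal rules may be applied only to theorems, that is, to formulas deducible from no
assumptions. -/
inductive Derives {Var : Type u} : Set (Formula Var) → Formula Var → Prop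
  | hyp {T : Set (Formula Var)} {φ : Formula Var} : φ ∈ T → Derives T φ
  | goedel {T : Set (Formula Var)} {φ : Formula Var} : GoedelAxiom φ → Derives T φ
  | modal {T : Set (Formula Var)} {φ : Formula Var} : ModalAxiom φ → Derives T φ
  | mp {T : Set (Formula Var)} {φ ψ : Formula Var} :
      Derives T (imp φ ψ) → Derives T φ → Derives T ψ
  | necBox {T : Set (Formula Var)} {φ : Formula Var} :
      Derives ∅ φ → Derives T (box φ)
  | monoDia {T : Set (Formula Var)} {φ ψ : Formula Var} :
      Derives ∅ (imp φ ψ) → Derives T (imp (dia φ) (dia ψ))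

/-- A Gödel–Kripke model: a non-empty set of worlds, a `[0,1]`-valued accessibility relation and
a `[0,1]`-valued valuation of the variables at each world. -/
structure GKModel (Var : Type u) where
  World : Type v
  nonempty : Nonempty World
  rel : World → World → unitInterval
  val : World → Var → unitInterval

/-- The Heyting implication `⇨` which Mathlib puts on `[0,1]` is the Gödel implication. -/
theorem himp_unitInterval (a b : unitInterval) : (a ⇨ b) = if a ≤ b then 1 else b := by
  split_ifs with h
  · exact himp_eq_top_iff.2 h
  · apply le_antisymm
    · have h1 : (a ⇨ b) ⊓ a ≤ b := himp_inf_le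
      rcases inf_le_iff.1 h1 with h2 | h2
      · exact h2
      · exact absurd h2 h
    · exact le_himp

/-- The extension of the valuation to all formulas, using the Heyting algebra structure and the
(complete) lattice operations of `[0,1]`. -/
noncomputable def GKModel.eval {Var : Type u} (M : GKModel.{u, v} Var) :
    M.World → Formula Var → unitInterval
  | x, .var p => M.val x p
  | _, .bot => 0
  | x, .and φ ψ => M.eval x φ ⊓ M.eval x ψ
  | x, .or φ ψ => M.eval x φ ⊔ M.eval x ψ
  | x, .imp φ ψ => M.eval x φ ⇨ M.eval x ψ
  | x, .box φ => ⨅ y : M.World, (M.rel x y ⇨ M.eval y φ)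
  | x, .dia φ => ⨆ y : M.World, (M.rel x y ⊓ M.eval y φ)

/-- `φ` is true in `M` at the world `x`. -/
def GKModel.TrueAt {Var : Type u} (M : GKModel.{u, v} Var) (x : M.World) (φ : Formula Var) :
    Prop :=
  M.eval x φ = 1

/-- `T ⊨_GK φ`: local semantic consequence over all Gödel–Kripke models. -/
def Entails {Var : Type u} (T : Set (Formula Var)) (φ : Formula Var) : Prop :=
  ∀ (M : GKModel.{u, v} Var) (x : M.World), (∀ θ ∈ T, M.TrueAt x θ) → M.TrueAt x φ

end BiModalGoedel

/-! Soundness is an induction on derivations, since `[0,1]` is a complete Heyting chain. For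
completeness, a formula not derivable from `T` is omitted by some prime theory containing `T`.
Prelinearity makes a prime theory order the formulas linearly, and countably many formulas then fit
into `[0,1]`. The result is a valuation in the sense of `IsVal`, where modal formulas count as
atoms. Valuations become the worlds of a canonical model, `w` being accessible from `v` to the
largest degree `s` with `s ⊓ v (□a) ≤ w a` and `s ⊓ w a ≤ v (◇a)` for all `a`. The truth lemma
(`eval_canonicalModel`) then only needs witnesses approximating each `v (□a)` and `v (◇a)`.

Witnesses are first built for finitely many constraints. A prime theory, separating boxes from
diamonds at a cut, prescribes the order of the new values; `IsVal.exists_glue` realizes that order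
by interpolating between the bounds that the constraints impose. Finiteness leaves room to choose
`s` between the cut and the nearby values. An ultrapower along finite fragments exhausting the
language yields witnesses for all formulas at once (`ValSeq.isWitnessed`), but with values in a
nonstandard interval. A Löwenheim–Skolem closure cuts this down to a countable family with values in
a countable dense chain, which Cantor's theorem embeds in `[0,1]` with dense image; density
preserves the approximations (`ValSeq.exists_isWitnessed`).

Only countably many variables occur in `T` and `φ`, so renaming reduces the general case to
countable `Var`. -/

namespace BiModalGoedel

open Formula

variable {Var : Type u}

/-! ### Derivations -/

theorem Derives.mono {T T' : Set (Formula Var)} (h : T ⊆ T') {φ : Formula Var}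
    (d : Derives T φ) : Derives T' φ := by
  induction d with
  | hyp h1 => exact .hyp (h h1)
  | goedel h1 => exact .goedel h1
  | modal h1 => exact .modal h1
  | mp _ _ ih1 ih2 => exact .mp (ih1 h) (ih2 h)
  | necBox d1 _ => exact .necBox d1
  | monoDia d1 _ => exact .monoDia d1

theorem Derives.imp_intro {T : Set (Formula Var)} {φ ψ : Formula Var} (d : Derives T ψ) :
    Derives T (imp φ ψ) :=
  .mp (.goedel (.k _ _)) d

theorem Derives.imp_self (T : Set (Formula Var)) (φ : Formula Var) : Derives T (imp φ φ) :=
  .mp (.mp (.goedel (.s φ (imp φ φ) φ)) (.goedel (.k _ _))) (.goedel (.k _ _))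

theorem Derives.deduction {T : Set (Formula Var)} {φ ψ : Formula Var}
    (d : Derives (insert φ T) ψ) : Derives T (imp φ ψ) := by
  generalize hT : insert φ T = T' at d
  induction d with
  | hyp h1 =>
    subst hT
    rcases h1 with rfl | h1
    · exact .imp_self _ _
    · exact (Derives.hyp h1).imp_intro
  | goedel h1 => exact (Derives.goedel h1).imp_intro
  | modal h1 => exact (Derives.modal h1).imp_intro
  | mp _ _ ih1 ih2 => exact .mp (.mp (.goedel (.s _ _ _)) (ih1 hT)) (ih2 hT)
  | necBox d1 _ => exact (Derives.necBox d1).imp_intro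
  | monoDia d1 _ => exact (Derives.monoDia d1).imp_intro

theorem Derives.or_elim {T : Set (Formula Var)} {φ ψ χ : Formula Var}
    (h1 : Derives T (imp φ χ)) (h2 : Derives T (imp ψ χ)) : Derives T (imp (or φ ψ) χ) :=
  .mp (.mp (.goedel (.orElim _ _ _)) h1) h2

theorem Derives.imp_trans {T : Set (Formula Var)} {φ ψ χ : Formula Var}
    (h1 : Derives T (imp φ ψ)) (h2 : Derives T (imp ψ χ)) : Derives T (imp φ χ) :=
  .mp (.mp (.goedel (.s _ _ _)) h2.imp_intro) h1

theorem Derives.imp_imp_self (φ ψ : Formula Var) :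
    Derives ∅ (imp φ (imp (imp φ ψ) ψ)) := by
  apply Derives.deduction
  apply Derives.deduction
  exact .mp (.hyp (by simp)) (.hyp (φ := φ) (by simp))

theorem Derives.or_imp_imp (φ ψ : Formula Var) :
    Derives ∅ (imp (or φ ψ) (imp (imp ψ φ) φ)) :=
  .or_elim (.goedel (.k _ _)) (.imp_imp_self _ _)

/-! ### Soundness -/

theorem inf_himp_inf_le_of_le {α : Type*} [HeytingAlgebra α] (a b c : α) :
    (a ⇨ (b ⇨ c)) ⊓ (a ⇨ b) ⊓ a ≤ c := by
  have h1 : (a ⇨ (b ⇨ c)) ⊓ (a ⇨ b) ⊓ a ≤ b :=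
    (inf_le_inf_right a inf_le_right).trans himp_inf_le
  have h2 : (a ⇨ (b ⇨ c)) ⊓ (a ⇨ b) ⊓ a ≤ b ⇨ c :=
    (inf_le_inf_right a inf_le_left).trans himp_inf_le
  exact (le_inf h2 h1).trans himp_inf_le

theorem GKModel.eval_goedelAxiom (M : GKModel.{u, v} Var) (x : M.World) {φ : Formula Var}
    (h : GoedelAxiom φ) : M.eval x φ = ⊤ := by
  cases h with
  | k φ ψ =>
    simp only [GKModel.eval, himp_eq_top_iff]
    exact le_himp
  | s φ ψ χ =>
    simp only [GKModel.eval, himp_eq_top_iff, le_himp_iff]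
    exact inf_himp_inf_le_of_le _ _ _
  | andLeft φ ψ => simp [GKModel.eval]
  | andRight φ ψ => simp [GKModel.eval]
  | andIntro φ ψ => simp [GKModel.eval, le_himp_iff]
  | orLeft φ ψ => simp [GKModel.eval]
  | orRight φ ψ => simp [GKModel.eval]
  | orElim φ ψ χ =>
    simp only [GKModel.eval, himp_eq_top_iff, le_himp_iff, inf_sup_left]
    refine sup_le ?_ ?_
    · exact (inf_le_inf_right _ inf_le_left).trans himp_inf_le
    · exact (inf_le_inf_right _ inf_le_right).trans himp_inf_le
  | exFalso φ =>
    simp only [GKModel.eval, himp_eq_top_iff]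
    exact bot_le
  | prelinearity φ ψ =>
    simp only [GKModel.eval]
    rcases le_total (M.eval x φ) (M.eval x ψ) with h | h
    · rw [himp_eq_top_iff.2 h, top_sup_eq]
    · rw [himp_eq_top_iff.2 h, sup_top_eq]

theorem GKModel.eval_modalAxiom (M : GKModel.{u, v} Var) (x : M.World) {φ : Formula Var}
    (h : ModalAxiom φ) : M.eval x φ = ⊤ := by
  have hbox : ∀ (φ : Formula Var) (y : M.World),
      M.eval x (box φ) ⊓ M.rel x y ≤ M.eval y φ := fun φ y =>
    le_himp_iff.1 (iInf_le (fun y => M.rel x y ⇨ M.eval y φ) y)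
  have hdia : ∀ (φ : Formula Var) (y : M.World),
      M.rel x y ⊓ M.eval y φ ≤ M.eval x (dia φ) := fun φ y =>
    le_iSup (fun y => M.rel x y ⊓ M.eval y φ) y
  have hbox' : ∀ (φ : Formula Var) (a : unitInterval),
      (∀ y, a ⊓ M.rel x y ≤ M.eval y φ) → a ≤ M.eval x (box φ) := fun φ a h =>
    le_iInf fun y => le_himp_iff.2 (h y)
  have hdia' : ∀ (φ : Formula Var) (a : unitInterval),
      (∀ y, M.rel x y ⊓ M.eval y φ ≤ a) → M.eval x (dia φ) ≤ a := fun φ a h =>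
    iSup_le h
  have himp : ∀ (y : M.World) (φ ψ : Formula Var),
      M.eval y (imp φ ψ) = (M.eval y φ ⇨ M.eval y ψ) := fun _ _ _ => rfl
  cases h with
  | kBox φ ψ =>
    rw [himp, himp_eq_top_iff, himp, le_himp_iff]
    refine hbox' _ _ fun y => ?_
    have h1 := hbox (imp φ ψ) y
    have h2 := hbox φ y
    refine le_trans (le_inf ?_ ?_) (himp_inf_le (a := M.eval y φ))
    · exact (inf_le_inf_right _ inf_le_left).trans h1
    · exact (inf_le_inf_right _ inf_le_right).trans h2
  | kDia φ ψ =>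
    rw [himp, himp_eq_top_iff]
    refine hdia' _ _ fun y => ?_
    change M.rel x y ⊓ (M.eval y φ ⊔ M.eval y ψ) ≤ M.eval x (dia φ) ⊔ M.eval x (dia ψ)
    rw [inf_sup_left]
    exact sup_le_sup (hdia φ y) (hdia ψ y)
  | fDia =>
    rw [neg, himp, himp_eq_top_iff]
    refine hdia' _ _ fun y => ?_
    exact inf_le_right
  | fs1 φ ψ =>
    rw [himp, himp_eq_top_iff]
    refine hdia' _ _ fun y => ?_
    rw [himp, himp, le_himp_iff]
    refine le_trans (le_inf ?_ ?_) (hdia ψ y)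
    · exact inf_le_left.trans inf_le_left
    · refine le_trans (le_inf (inf_le_left.trans inf_le_right) ?_)
        (himp_inf_le (a := M.eval y φ))
      exact le_trans (le_inf inf_le_right (inf_le_left.trans inf_le_left)) (hbox φ y)
  | fs2 φ ψ =>
    rw [himp, himp_eq_top_iff, himp]
    refine hbox' _ _ fun y => ?_
    rw [himp, le_himp_iff, inf_assoc]
    refine le_trans (le_inf ?_ (inf_le_right.trans inf_le_left)) (hbox ψ y)
    exact (inf_le_inf_left _ (hdia φ y)).trans himp_inf_le

theorem Derives.sound {T : Set (Formula Var)} {φ : Formula Var} (d : Derives T φ) :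
    Entails.{u, v} T φ := by
  induction d with
  | hyp h => exact fun M x hx => hx _ h
  | goedel h => exact fun M x _ => M.eval_goedelAxiom x h
  | modal h => exact fun M x _ => M.eval_modalAxiom x h
  | mp _ _ ih1 ih2 =>
    intro M x hx
    have h1 := ih1 M x hx
    have h2 := ih2 M x hx
    exact top_le_iff.1 (h2.ge.trans (himp_eq_top_iff.1 h1))
  | necBox _ ih =>
    intro M x _
    refine top_le_iff.1 (le_iInf fun y => ?_)
    rw [show M.eval y _ = ⊤ from ih M y (by simp), himp_top]
  | monoDia _ ih =>
    intro M x _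
    refine himp_eq_top_iff.2 (iSup_mono fun y => inf_le_inf_left _ ?_)
    exact himp_eq_top_iff.1 (ih M y (by simp))

/-! ### Prime theories -/

/-- A theory: a set of formulas containing all theorems and closed under modus ponens. -/
structure IsTheory (S : Set (Formula Var)) : Prop where
  of_derives {φ : Formula Var} : Derives ∅ φ → φ ∈ S
  mp {φ ψ : Formula Var} : imp φ ψ ∈ S → φ ∈ S → ψ ∈ S

theorem IsTheory.mp_derives {S : Set (Formula Var)} (hS : IsTheory S) {φ ψ : Formula Var}
    (h : Derives ∅ (imp φ ψ)) (h' : φ ∈ S) : ψ ∈ S :=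
  hS.mp (hS.of_derives h) h'

theorem isTheory_derives (T : Set (Formula Var)) : IsTheory {φ | Derives T φ} :=
  ⟨fun h => h.mono (Set.empty_subset _), fun h h' => .mp h h'⟩

/-- The deduction theorem in semantic dress: this set stands for the theory generated by `S` and
`φ`. -/
theorem IsTheory.imp_set {S : Set (Formula Var)} (hS : IsTheory S) (φ : Formula Var) :
    IsTheory {χ | imp φ χ ∈ S} :=
  ⟨fun h => hS.of_derives h.imp_intro,
    fun h h' => hS.mp (hS.mp (hS.of_derives (.goedel (.s _ _ _))) h) h'⟩

/-- A prime theory that omits `⊥`. -/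
structure IsPrimeTheory (Q : Set (Formula Var)) : Prop extends IsTheory Q where
  bot_notMem : bot ∉ Q
  prime {φ ψ : Formula Var} : or φ ψ ∈ Q → φ ∈ Q ∨ ψ ∈ Q

/-- Separation of a theory from a set directed under disjunction by a prime theory. -/
theorem IsTheory.exists_prime {S : Set (Formula Var)} (hS : IsTheory S)
    {Δ : Set (Formula Var)} (hne : Δ.Nonempty)
    (hΔ : ∀ δ₁ ∈ Δ, ∀ δ₂ ∈ Δ, ∃ δ ∈ Δ, Derives ∅ (imp (or δ₁ δ₂) δ))
    (hdisj : ∀ δ ∈ Δ, δ ∉ S) :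
    ∃ Q, IsPrimeTheory Q ∧ S ⊆ Q ∧ ∀ δ ∈ Δ, δ ∉ Q := by
  obtain ⟨Q, hSQ, hQ⟩ := zorn_subset_nonempty
    {R : Set (Formula Var) | IsTheory R ∧ ∀ δ ∈ Δ, δ ∉ R} (by
      intro c hc hchain hcne
      refine ⟨⋃₀ c, ⟨⟨?_, ?_⟩, ?_⟩, fun s hs => Set.subset_sUnion_of_mem hs⟩
      · intro φ hφ
        obtain ⟨R, hR⟩ := hcne
        exact ⟨R, hR, (hc hR).1.of_derives hφ⟩
      · rintro φ ψ ⟨R₁, h₁, hm₁⟩ ⟨R₂, h₂, hm₂⟩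
        rcases hchain.total h₁ h₂ with h | h
        · exact ⟨R₂, h₂, (hc h₂).1.mp (h hm₁) hm₂⟩
        · exact ⟨R₁, h₁, (hc h₁).1.mp hm₁ (h hm₂)⟩
      · rintro δ hδ ⟨R, hR, hm⟩
        exact (hc hR).2 δ hδ hm) S ⟨hS, hdisj⟩
  -- By maximality, adjoining `φ` to `Q` must hit `Δ`.
  have hmeet : ∀ φ, φ ∉ Q → ∃ δ ∈ Δ, imp φ δ ∈ Q := by
    intro φ hφ
    by_contra! hcon
    have hsub : Q ⊆ {χ | imp φ χ ∈ Q} := fun χ hχ =>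
      hQ.prop.1.mp_derives (.goedel (.k _ _)) hχ
    have := hQ.le_of_ge ⟨hQ.prop.1.imp_set φ, hcon⟩ hsub
    exact hφ (this (hQ.prop.1.of_derives (.imp_self _ _)))
  refine ⟨Q, ⟨hQ.prop.1, ?_, ?_⟩, hSQ, hQ.prop.2⟩
  · intro hb
    obtain ⟨δ, hδ⟩ := hne
    exact hQ.prop.2 δ hδ (hQ.prop.1.mp_derives (.goedel (.exFalso _)) hb)
  · intro φ ψ hor
    by_contra! hcon
    obtain ⟨δ₁, hδ₁, h₁⟩ := hmeet φ hcon.1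
    obtain ⟨δ₂, hδ₂, h₂⟩ := hmeet ψ hcon.2
    obtain ⟨δ, hδ, hd⟩ := hΔ _ hδ₁ _ hδ₂
    have ht := hQ.prop.1
    refine hQ.prop.2 δ hδ (ht.mp_derives hd ?_)
    refine ht.mp (ht.mp (ht.mp (ht.of_derives (.goedel (.orElim φ ψ _))) ?_) ?_) hor
    · exact ht.mp ((ht.imp_set φ).of_derives (.goedel (.orLeft δ₁ δ₂)) |> fun h =>
        ht.mp (ht.of_derives (.goedel (.s _ _ _))) h) h₁
    · exact ht.mp ((ht.imp_set ψ).of_derives (.goedel (.orRight δ₁ δ₂)) |> fun h =>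
        ht.mp (ht.of_derives (.goedel (.s _ _ _))) h) h₂

theorem IsTheory.imp_trans {S : Set (Formula Var)} (hS : IsTheory S) {φ ψ χ : Formula Var}
    (h₁ : imp φ ψ ∈ S) (h₂ : imp ψ χ ∈ S) : imp φ χ ∈ S :=
  (hS.imp_set φ).mp (hS.mp_derives (.goedel (.k _ _)) h₂) h₁

theorem IsPrimeTheory.total {Q : Set (Formula Var)} (hQ : IsPrimeTheory Q) (φ ψ : Formula Var) :
    imp φ ψ ∈ Q ∨ imp ψ φ ∈ Q :=
  hQ.prime (hQ.of_derives (.goedel (.prelinearity _ _)))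

/-! ### Valuations in a Gödel chain -/

/-- A valuation of formulas in a bounded chain which respects the propositional connectives of
Gödel logic and sends all theorems to `⊤`; the values of modal formulas are otherwise free. -/
structure IsVal {C : Type*} [LinearOrder C] [BoundedOrder C] (v : Formula Var → C) : Prop where
  map_bot : v bot = ⊥
  map_and (a b : Formula Var) : v (and a b) = v a ⊓ v b
  map_or (a b : Formula Var) : v (or a b) = v a ⊔ v b
  imp_of_le {a b : Formula Var} : v a ≤ v b → v (imp a b) = ⊤
  imp_of_lt {a b : Formula Var} : v b < v a → v (imp a b) = v b
  thm {a : Formula Var} : Derives ∅ a → v a = ⊤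

namespace IsVal

variable {C : Type*} [LinearOrder C] [BoundedOrder C] {v : Formula Var → C}

/-- In a chain the connectives are determined by the order and by which formulas are `⊤`, so it is
enough that `v` reflects the linear order that `Q` puts on formulas. -/
theorem of_prime {Q : Set (Formula Var)} (hQ : IsPrimeTheory Q) (htop : ∀ a ∈ Q, v a = ⊤)
    (hbot : v bot = ⊥) (hmono : ∀ a b, imp a b ∈ Q → v a ≤ v b)
    (hstrict : ∀ a b, imp b a ∉ Q → v a < v b) : IsVal v where
  map_bot := hbot
  map_and a b := by
    refine le_antisymm (le_inf (hmono _ _ (hQ.of_derives (.goedel (.andLeft _ _))))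
      (hmono _ _ (hQ.of_derives (.goedel (.andRight _ _))))) ?_
    rcases hQ.total a b with h | h
    · refine inf_le_left.trans (hmono _ _ ?_)
      exact hQ.mp (hQ.mp_derives (.goedel (.s a b (a.and b)))
        (hQ.of_derives (.goedel (.andIntro _ _)))) h
    · refine inf_le_right.trans (hmono _ _ ?_)
      refine hQ.of_derives ?_ |> fun hd => hQ.mp hd h
      apply Derives.deduction
      apply Derives.deduction
      refine .mp (.mp (.goedel (.andIntro _ _)) (.mp (φ := b) (.hyp ?_) (.hyp ?_))) (.hyp ?_) <;>
        simp
  map_or a b := by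
    refine le_antisymm ?_ (sup_le (hmono _ _ (hQ.of_derives (.goedel (.orLeft _ _))))
      (hmono _ _ (hQ.of_derives (.goedel (.orRight _ _)))))
    rcases hQ.total a b with h | h
    · refine (hmono _ _ ?_).trans le_sup_right
      exact hQ.mp (hQ.mp_derives (.goedel (.orElim _ _ _)) h) (hQ.of_derives (.imp_self _ _))
    · refine (hmono _ _ ?_).trans le_sup_left
      exact hQ.mp (hQ.mp_derives (.goedel (.orElim _ _ _)) (hQ.of_derives (.imp_self _ _))) h
  imp_of_le {a b} h := by
    apply htop
    by_contra hcon
    exact absurd (hstrict _ _ hcon) (not_lt.2 h)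
  imp_of_lt {a b} h := by
    refine le_antisymm (hmono _ _ ?_) (hmono _ _ (hQ.of_derives (.goedel (.k _ _))))
    have hab : imp a b ∉ Q := fun hm => absurd (hmono _ _ hm) (not_le.2 h)
    rcases hQ.total (imp a b) a with h1 | h1
    · exact hQ.mp (hQ.mp_derives (.goedel (.s _ _ _)) (hQ.of_derives (.imp_self _ _))) h1
    · exact absurd (hQ.mp (hQ.mp_derives (.goedel (.s _ _ _)) h1)
        (hQ.of_derives (.imp_self _ _))) hab
  thm h := htop _ (hQ.of_derives h)

theorem le_imp_iff (hv : IsVal v) {a b : Formula Var} {c : C} :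
    c ≤ v (imp a b) ↔ c ⊓ v a ≤ v b := by
  rcases le_or_gt (v a) (v b) with h | h
  · rw [hv.imp_of_le h]
    exact ⟨fun _ => inf_le_right.trans h, fun _ => le_top⟩
  · rw [hv.imp_of_lt h, inf_le_iff]
    exact ⟨Or.inl, fun h' => h'.resolve_right (not_le.2 h)⟩

theorem mono (hv : IsVal v) {a b : Formula Var} (h : Derives ∅ (imp a b)) : v a ≤ v b := by
  simpa using hv.le_imp_iff.1 (hv.thm h).ge

theorem box_mp (hv : IsVal v) (a b : Formula Var) :
    v (box (imp a b)) ⊓ v (box a) ≤ v (box b) :=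
  hv.le_imp_iff.1 (hv.mono (.modal (.kBox _ _)))

theorem box_mono (hv : IsVal v) {a b : Formula Var} (h : Derives ∅ (imp a b)) :
    v (box a) ≤ v (box b) :=
  hv.mono (.mp (.modal (.kBox _ _)) (.necBox h))

theorem dia_mono (hv : IsVal v) {a b : Formula Var} (h : Derives ∅ (imp a b)) :
    v (dia a) ≤ v (dia b) :=
  hv.mono (.monoDia h)

theorem dia_or (hv : IsVal v) (a b : Formula Var) :
    v (dia (or a b)) ≤ v (dia a) ⊔ v (dia b) :=
  (hv.mono (.modal (.kDia _ _))).trans (hv.map_or _ _).le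

theorem dia_bot (hv : IsVal v) : v (dia bot) = ⊥ :=
  le_bot_iff.1 ((hv.mono (.modal .fDia)).trans hv.map_bot.le)

theorem fs1 (hv : IsVal v) (a b : Formula Var) :
    v (dia (imp a b)) ⊓ v (box a) ≤ v (dia b) :=
  hv.le_imp_iff.1 (hv.mono (.modal (.fs1 _ _)))

theorem fs2 (hv : IsVal v) {a b : Formula Var} (h : v (dia a) ≤ v (box b)) :
    v (box (imp a b)) = ⊤ :=
  top_le_iff.1 ((hv.imp_of_le h).ge.trans (hv.mono (.modal (.fs2 _ _))))

/-- The formula `or a b` proves `(b → a) → a`, and under the hypothesis the second Fischer Servi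
axiom gives `□(b → a)` the value `⊤`. -/
theorem box_or (hv : IsVal v) {a b : Formula Var} (h : v (dia b) ≤ v (box a)) :
    v (box (or a b)) ≤ v (box a) := by
  have h1 := hv.box_mono (.or_imp_imp a b)
  have h2 := hv.box_mp (imp b a) a
  rw [hv.fs2 h, inf_top_eq] at h2
  exact h1.trans h2

theorem dia_mp (hv : IsVal v) (a b : Formula Var) :
    v (box (imp a b)) ⊓ v (dia a) ≤ v (dia b) := by
  rw [inf_comm]
  exact (inf_le_inf_right _ (hv.dia_mono (.imp_imp_self a b))).trans (hv.fs1 _ _)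

theorem box_thm (hv : IsVal v) {a : Formula Var} (h : Derives ∅ a) : v (box a) = ⊤ :=
  hv.thm (.necBox h)

end IsVal

/-- The order of a prime theory on countably many formulas is represented in `[0, 1/2]`. -/
theorem IsPrimeTheory.exists_strictMono [Countable (Formula Var)] {Q : Set (Formula Var)}
    (hQ : IsPrimeTheory Q) : ∃ g : Formula Var → ℝ, (∀ a, 0 ≤ g a) ∧ (∀ a, g a ≤ 1 / 2) ∧
      g bot = 0 ∧ (∀ a b, imp a b ∈ Q → g a ≤ g b) ∧ ∀ a b, imp b a ∉ Q → g a < g b := by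
  classical
  have : Encodable (Formula Var) := Encodable.ofCountable _
  obtain ⟨ε, hpos, c, hc, hle⟩ := posSumOfEncodable (ε := 1 / 2) (by norm_num) (Formula Var)
  -- The number attached to `a` is the total weight of the `χ` not implied by `a`: larger formulas
  -- imply less. If `b → a` is not in `Q`, the index `χ = a` counts for `b` but not for `a`, which
  -- gives strictness.
  let t : Formula Var → Formula Var → ℝ := fun a χ => if imp a χ ∈ Q then 0 else ε χ
  have ht0 : ∀ a χ, 0 ≤ t a χ := fun a χ => by
    dsimp only [t]; split_ifs; exacts [le_rfl, (hpos χ).le]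
  have htε : ∀ a χ, t a χ ≤ ε χ := fun a χ => by
    dsimp only [t]; split_ifs; exacts [(hpos χ).le, le_rfl]
  have hs : ∀ a, Summable (t a) := fun a => .of_nonneg_of_le (ht0 a) (htε a) hc.summable
  have hmono : ∀ a b, imp a b ∈ Q → ∀ χ, t a χ ≤ t b χ := fun a b hab χ => by
    by_cases h : imp b χ ∈ Q
    · simp [t, h, hQ.imp_trans hab h]
    · simpa [t, h] using htε a χ
  refine ⟨fun a => ∑' χ, t a χ, fun a => tsum_nonneg (ht0 a), fun a => ?_, ?_,
    fun a b hab => (hs a).tsum_le_tsum (hmono a b hab) (hs b), fun a b hab => ?_⟩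
  · exact ((hs a).tsum_le_tsum (htε a) hc.summable).trans (hc.tsum_eq.trans_le hle)
  · have : t bot = fun _ => 0 := by
      funext χ
      simp [t, hQ.of_derives (.goedel (.exFalso χ))]
    simp [this]
  · have hba : imp a b ∈ Q := (hQ.total a b).resolve_right hab
    refine Summable.tsum_lt_tsum (i := a) (hmono a b hba) ?_ (hs a) (hs b)
    simp [t, hab, hQ.of_derives (.imp_self _ a), hpos]

theorem IsPrimeTheory.exists_isVal [Countable (Formula Var)] {Q : Set (Formula Var)}
    (hQ : IsPrimeTheory Q) :
    ∃ v : Formula Var → unitInterval, IsVal v ∧ ∀ a, v a = 1 ↔ a ∈ Q := by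
  classical
  obtain ⟨g, hg0, hg1, hgb, hgm, hgs⟩ := hQ.exists_strictMono
  -- Since `g ≤ 1/2`, the value `1` is reserved for the members of `Q`.
  let v : Formula Var → unitInterval := fun a =>
    if a ∈ Q then 1 else ⟨g a, hg0 a, (hg1 a).trans (by norm_num)⟩
  have hlt : ∀ a, a ∉ Q → v a < 1 := fun a ha => by
    simp only [v, ha, if_false]
    rw [← Subtype.coe_lt_coe]
    exact (hg1 a).trans_lt (by norm_num)
  have htop : ∀ a ∈ Q, v a = 1 := fun a ha => by simp [v, ha]
  refine ⟨v, .of_prime hQ htop ?_ ?_ ?_, fun a => ⟨fun h => ?_, htop a⟩⟩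
  · simp only [v, hQ.bot_notMem, if_false, hgb]; rfl
  · intro a b hab
    by_cases hb : b ∈ Q
    · rw [htop b hb]; exact le_top
    · have ha : a ∉ Q := fun ha => hb (hQ.mp hab ha)
      simp only [v, ha, hb, if_false]
      exact hgm a b hab
  · intro a b hab
    have ha : a ∉ Q := fun ha => hab (hQ.mp_derives (.goedel (.k _ _)) ha)
    by_cases hb : b ∈ Q
    · rw [htop b hb]; exact hlt a ha
    · simp only [v, ha, hb, if_false]
      exact hgs a b hab
  · by_contra ha
    exact (hlt a ha).ne h

/-! ### Witnesses for modal formulas relative to a finite fragment -/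

/-- If `l' < u'`, the larger weight `g'` gives strictness. If `l' = u'`, the right side is this
common value, and the weight `1 - g > 0` on `l < u'` does. -/
theorem sub_mul_add_mul_lt {l l' u u' g g' : ℝ} (hg : 0 ≤ g) (hg' : g' < 1) (hgg : g < g')
    (hl : l ≤ l') (hu : u ≤ u') (h' : l' ≤ u') (hlu : l < u') :
    (1 - g) * l + g * u < (1 - g') * l' + g' * u' := by
  rcases h'.lt_or_eq with h | h
  · nlinarith [mul_pos (sub_pos.2 hgg) (sub_pos.2 h),
      mul_nonneg (sub_nonneg.2 (hgg.trans hg').le) (sub_nonneg.2 hl),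
      mul_nonneg hg (sub_nonneg.2 hu)]
  · subst h
    nlinarith [mul_nonneg hg (sub_nonneg.2 hu), mul_pos (sub_pos.2 (hgg.trans hg'))
      (sub_pos.2 hlu)]

/-- The gluing lemma: a prime theory `Q` lying between the box part and the diamond part of a
valuation `v` at a cut `H` is realized by a valuation `w` which is compatible with `v` below `s`,
as far as finitely many formulas are concerned. -/
theorem IsVal.exists_glue [Countable (Formula Var)] {v : Formula Var → unitInterval}
    (hv : IsVal v) {Q : Set (Formula Var)} (hQ : IsPrimeTheory Q) {H : Set unitInterval}
    (hH : IsUpperSet H) (hbox : ∀ a, v (box a) ∈ H → a ∈ Q) (hdia : ∀ a ∈ Q, v (dia a) ∈ H)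
    (F : Finset (Formula Var)) {s : unitInterval}
    (hs : ∀ a ∈ F, v (dia a) ∈ H → s ≤ v (dia a))
    (hs' : ∀ a ∈ F, v (box a) ∉ H → v (box a) < s) (hs0 : 0 < s) :
    ∃ w : Formula Var → unitInterval, IsVal w ∧ (∀ a ∈ Q, w a = 1) ∧ (∀ a ∉ Q, w a < s) ∧
      ∀ a ∈ F, s ⊓ v (box a) ≤ w a ∧ s ⊓ w a ≤ v (dia a) := by
  classical
  obtain ⟨g, hg0, hg1, hgb, hgm, hgs⟩ := hQ.exists_strictMono
  -- Monotonicity and the constraints from `F` force the value of `b ∉ Q` to be at least `l b` and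
  -- at most the second term of `u b`; the `s` in `u` keeps it below the degree of accessibility.
  let l : Formula Var → unitInterval := fun b =>
    (F.filter fun a => imp a b ∈ Q).sup fun a => v (box a)
  let u : Formula Var → unitInterval := fun b =>
    s ⊓ (F.filter fun a => a ∉ Q ∧ imp b a ∈ Q).inf fun a => v (dia a)
  -- The cut `H` contains `1`, being an upper set that contains the diamond of a theorem; so `□(a →
  -- c)`, of value `1` by the second Fischer Servi axiom, puts `a → c` into `Q`.
  have hboxle : ∀ a c, v (dia a) ≤ v (box c) → imp a c ∈ Q := fun a c h =>
    hbox _ (by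
      rw [hv.fs2 h]
      exact hH le_top (hdia _ (hQ.of_derives (.imp_self _ bot))))
  have hls : ∀ b, b ∉ Q → l b < s := fun b hb => by
    refine (Finset.sup_lt_iff hs0).2 fun a ha => ?_
    rw [Finset.mem_filter] at ha
    exact hs' a ha.1 fun h => hb (hQ.mp ha.2 (hbox a h))
  -- If `◇c` were below `□a`, the first Fischer Servi axiom would bound `◇(a → c)` by `◇c`. As `a →
  -- c` is in `Q`, both `◇c` and `□a` would lie in `H`, forcing `a` and then `b` into `Q`.
  have hlu : ∀ b, b ∉ Q → l b ≤ u b := fun b hb => by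
    refine le_inf (hls b hb).le (Finset.le_inf fun c hc => Finset.sup_le fun a ha => ?_)
    rw [Finset.mem_filter] at ha hc
    by_contra! hcon
    have h1 : v (dia (imp a c)) ≤ v (dia c) := by
      have := hv.fs1 a c
      rcases inf_le_iff.1 this with h | h
      · exact h
      · exact absurd h (not_le.2 hcon)
    have h2 := hH h1 (hdia _ (hQ.imp_trans ha.2 hc.2.2))
    exact hb (hQ.mp ha.2 (hbox a (hH hcon.le h2)))
  -- A bound `◇c ≤ □a` would give `c → a` in `Q` by `hboxle`, hence the chain `b' → c → a → b`.
  have hlu' : ∀ b b', b ∉ Q → b' ∉ Q → imp b' b ∉ Q → l b < u b' := fun b b' hb hb' hbb => by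
    refine lt_inf_iff.2 ⟨hls b hb, ?_⟩
    refine (Finset.lt_inf_iff (lt_of_lt_of_le (hls b hb) le_top)).2 fun c hc => ?_
    rw [Finset.mem_filter] at hc
    have hpos : ⊥ < v (dia c) := by
      rw [bot_lt_iff_ne_bot]
      intro h0
      exact hbb (hQ.imp_trans (hQ.imp_trans hc.2.2 (hboxle c bot (h0.le.trans bot_le)))
        (hQ.of_derives (.goedel (.exFalso _))))
    refine (Finset.sup_lt_iff hpos).2 fun a ha => ?_
    rw [Finset.mem_filter] at ha
    by_contra! hcon
    exact hbb (hQ.imp_trans hc.2.2 (hQ.imp_trans (hboxle c a hcon) ha.2))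
  have hlm : ∀ b b', imp b b' ∈ Q → l b ≤ l b' := fun b b' h =>
    Finset.sup_mono fun a ha => by
      rw [Finset.mem_filter] at ha ⊢
      exact ⟨ha.1, hQ.imp_trans ha.2 h⟩
  have hum : ∀ b b', imp b b' ∈ Q → u b ≤ u b' := fun b b' h =>
    inf_le_inf_left _ (Finset.inf_mono fun a ha => by
      rw [Finset.mem_filter] at ha ⊢
      exact ⟨ha.1, ha.2.1, hQ.imp_trans h ha.2.2⟩)
  -- Interpolating with the order representation `g` as weight makes the values strictly increasing
  -- even where `l` and `u` are constant.
  let f : Formula Var → ℝ := fun b => (1 - g b) * l b + g b * u b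
  have hfl : ∀ b, b ∉ Q → (l b : ℝ) ≤ f b := fun b hb => by
    have : (l b : ℝ) ≤ u b := hlu b hb
    dsimp only [f]
    nlinarith [hg0 b]
  have hfu : ∀ b, b ∉ Q → f b ≤ u b := fun b hb => by
    have : (l b : ℝ) ≤ u b := hlu b hb
    dsimp only [f]
    nlinarith [hg1 b]
  have hfs : ∀ b, b ∉ Q → f b < s := fun b hb => by
    have h1 : (l b : ℝ) < s := hls b hb
    have h2 : (u b : ℝ) ≤ s := (inf_le_left : u b ≤ s)
    dsimp only [f]
    nlinarith [hg1 b, hg0 b]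
  have hf : ∀ b, f b ∈ Set.Icc (0 : ℝ) 1 := fun b => by
    have h1 := (l b).2
    have h2 := (u b).2
    have h3 := hg0 b
    have h4 : 0 ≤ 1 - g b := by linarith [hg1 b]
    constructor
    · have := mul_nonneg h3 h2.1
      have := mul_nonneg h4 h1.1
      dsimp only [f]; linarith
    · have := mul_le_mul_of_nonneg_left h2.2 h3
      have := mul_le_mul_of_nonneg_left h1.2 h4
      dsimp only [f]; linarith
  let w : Formula Var → unitInterval := fun b => if b ∈ Q then 1 else ⟨f b, hf b⟩
  have hw1 : ∀ b ∈ Q, w b = 1 := fun b hb => by simp [w, hb]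
  have hw : ∀ b, b ∉ Q → w b = ⟨f b, hf b⟩ := fun b hb => by simp [w, hb]
  have hws : ∀ b, b ∉ Q → w b < s := fun b hb => by
    rw [hw b hb]
    exact hfs b hb
  refine ⟨w, .of_prime hQ hw1 ?_ ?_ ?_, hw1, hws, fun a ha => ⟨?_, ?_⟩⟩
  · rw [hw _ hQ.bot_notMem]
    apply Subtype.ext
    change f bot = 0
    -- Since `g bot = 0`, only the lower bound matters. A positive `□a` with `a → ⊥` in `Q` would
    -- force `◇(a → ⊥)` to be `0`, so `0` would be in `H` and `⊥` in `Q`.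
    have : l bot = ⊥ := by
      refine le_bot_iff.1 (Finset.sup_le fun a ha => ?_)
      rw [Finset.mem_filter] at ha
      by_contra hcon
      have h1 : v (dia (imp a bot)) = ⊥ := by
        have := hv.fs1 a bot
        rw [hv.dia_bot] at this
        rcases inf_le_iff.1 this with h | h
        · exact le_bot_iff.1 h
        · exact absurd h hcon
      have h2 := hdia _ ha.2
      rw [h1] at h2
      exact hQ.bot_notMem (hbox _ (hH bot_le h2))
    have h0 : ((l bot : unitInterval) : ℝ) = 0 := by rw [this]; rfl
    simp [f, hgb, h0]
  · intro a b hab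
    by_cases hb : b ∈ Q
    · rw [hw1 b hb]; exact le_top
    · have ha : a ∉ Q := fun ha => hb (hQ.mp hab ha)
      rw [hw a ha, hw b hb]
      change f a ≤ f b
      have h1 : (l a : ℝ) ≤ l b := hlm a b hab
      have h2 : (u a : ℝ) ≤ u b := hum a b hab
      have h3 : (l b : ℝ) ≤ u b := hlu b hb
      have h4 := hgm a b hab
      dsimp only [f]
      nlinarith [mul_nonneg (hg0 a) (sub_nonneg.2 h2), mul_nonneg (sub_nonneg.2 h4)
        (sub_nonneg.2 h3), mul_nonneg (show 0 ≤ 1 - g a by linarith [hg1 a]) (sub_nonneg.2 h1)]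
  · intro a b hab
    have ha : a ∉ Q := fun ha => hab (hQ.mp_derives (.goedel (.k _ _)) ha)
    by_cases hb : b ∈ Q
    · rw [hw1 b hb]
      exact (hws a ha).trans_le le_top
    · rw [hw a ha, hw b hb]
      have hab' : imp a b ∈ Q := (hQ.total a b).resolve_right hab
      exact sub_mul_add_mul_lt (hg0 a) ((hg1 b).trans_lt (by norm_num)) (hgs a b hab)
        (hlm a b hab') (hum a b hab') (hlu b hb) (hlu' a b ha hb hab)
  · by_cases h : a ∈ Q
    · rw [hw1 a h]; exact le_top
    · rw [hw a h]
      refine inf_le_right.trans (le_trans ?_ (hfl a h : l a ≤ ⟨f a, hf a⟩))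
      exact Finset.le_sup (f := fun a => v (box a))
        (Finset.mem_filter.2 ⟨ha, hQ.of_derives (.imp_self _ _)⟩)
  · by_cases h : a ∈ Q
    · exact inf_le_left.trans (hs a ha (hdia a h))
    · rw [hw a h]
      refine inf_le_right.trans (le_trans (hfu a h : (⟨f a, hf a⟩ : unitInterval) ≤ u a) ?_)
      refine inf_le_right.trans (Finset.inf_le (f := fun a => v (dia a)) ?_)
      exact Finset.mem_filter.2 ⟨ha, h, hQ.of_derives (.imp_self _ _)⟩

/-- The cut lies just above `v (□φ)`. The prime theory must omit `φ` and every `ψ` with `◇ψ ≤ □φ`;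
`IsVal.box_or` shows that the theory of all `a` with `□a > □φ` avoids their disjunctions with `φ`.
-/
theorem IsVal.exists_box_witness [Countable (Formula Var)] {v : Formula Var → unitInterval}
    (hv : IsVal v) {φ : Formula Var} {c : unitInterval} (hc : v (box φ) < c)
    (F : Finset (Formula Var)) :
    ∃ (w : Formula Var → unitInterval) (s : unitInterval), IsVal w ∧ w φ < c ∧ w φ < s ∧
      ∀ a ∈ F, s ⊓ v (box a) ≤ w a ∧ s ⊓ w a ≤ v (dia a) := by
  have hS : IsTheory {a | v (box φ) < v (box a)} := by
    refine ⟨fun h => ?_, fun {a b} h1 h2 => ?_⟩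
    · rw [Set.mem_ofPred, hv.box_thm h]
      exact hc.trans_le le_top
    · exact (lt_inf_iff.2 ⟨h1, h2⟩).trans_le (hv.box_mp a b)
  obtain ⟨Q, hQ, hSQ, hΔ⟩ := hS.exists_prime
    (Δ := {δ | ∃ ψ, v (dia ψ) ≤ v (box φ) ∧ Derives ∅ (imp δ (or φ ψ))})
    ⟨φ, bot, by rw [hv.dia_bot]; exact bot_le, .goedel (.orLeft _ _)⟩
    (by
      rintro δ₁ ⟨ψ₁, h₁, d₁⟩ δ₂ ⟨ψ₂, h₂, d₂⟩
      refine ⟨or φ (or ψ₁ ψ₂), ⟨or ψ₁ ψ₂, (hv.dia_or _ _).trans (sup_le h₁ h₂), .imp_self _ _⟩, ?_⟩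
      refine .or_elim (d₁.imp_trans ?_) (d₂.imp_trans ?_)
      · exact .or_elim (.goedel (.orLeft _ _))
          (.imp_trans (.goedel (.orLeft _ _)) (.goedel (.orRight _ _)))
      · exact .or_elim (.goedel (.orLeft _ _))
          (.imp_trans (.goedel (.orRight _ _)) (.goedel (.orRight _ _))))
    (by
      rintro δ ⟨ψ, h, d⟩ hδ
      exact absurd ((hv.box_mono d).trans (hv.box_or h)) (not_le.2 hδ))
  have hNe : (nhdsWithin (v (box φ)) (Set.Ioi (v (box φ)))).NeBot :=
    nhdsGT_neBot_of_exists_gt ⟨c, hc⟩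
  have hev : ∀ x : unitInterval, v (box φ) < x →
      ∀ᶠ s in nhdsWithin (v (box φ)) (Set.Ioi (v (box φ))), s < x := fun x hx =>
    nhdsWithin_le_nhds (Iio_mem_nhds hx)
  -- Just above `v (□φ)` there is room below `c` and below the finitely many larger diamond values
  -- of `F`.
  obtain ⟨s, hsF, hsc, hs⟩ := (((Finset.eventually_all F).2 fun a _ =>
    (Filter.eventually_imp_distrib_left.2 (hev (v (dia a))))).and
      ((hev c hc).and self_mem_nhdsWithin)).exists
  obtain ⟨w, hw, -, hw2, hw3⟩ := hv.exists_glue hQ (H := Set.Ioi (v (box φ))) (isUpperSet_Ioi _)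
    (fun a ha => hSQ ha)
    (fun a ha => by
      by_contra hcon
      exact hΔ a ⟨a, not_lt.1 hcon, .goedel (.orRight _ _)⟩ ha)
    F (fun a ha h => (hsF a ha h).le) (fun a _ h => (not_lt.1 h).trans_lt hs)
    (bot_le.trans_lt hs)
  have hφ : w φ < s := hw2 φ (hΔ φ ⟨bot, by rw [hv.dia_bot]; exact bot_le, .goedel (.orLeft _ _)⟩)
  exact ⟨w, s, hw, hφ.trans hsc, hφ, hw3⟩

/-- Dually, the cut starts at `v (◇φ)`. The theory used here contains `φ` and, by `IsVal.dia_mp`, no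
formula whose diamond is below `◇φ`; so `φ` gets value `1`, and `s` is taken just below `v (◇φ)`. -/
theorem IsVal.exists_dia_witness [Countable (Formula Var)] {v : Formula Var → unitInterval}
    (hv : IsVal v) {φ : Formula Var} {c : unitInterval} (hc : c < v (dia φ))
    (F : Finset (Formula Var)) :
    ∃ (w : Formula Var → unitInterval) (s : unitInterval), IsVal w ∧ c < w φ ∧ c < s ∧
      ∀ a ∈ F, s ⊓ v (box a) ≤ w a ∧ s ⊓ w a ≤ v (dia a) := by
  have hS : IsTheory {a | v (dia φ) ≤ v (box (imp φ a))} := by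
    refine ⟨fun h => ?_, fun {a b} h1 h2 => ?_⟩
    · rw [Set.mem_ofPred, hv.box_thm h.imp_intro]
      exact le_top
    · have h3 := (hv.box_mono (.goedel (.s φ a b))).trans' h1
      exact (le_inf h3 h2).trans (hv.box_mp _ _)
  obtain ⟨Q, hQ, hSQ, hΔ⟩ := hS.exists_prime (Δ := {δ | v (dia δ) < v (dia φ)})
    ⟨bot, by rw [Set.mem_ofPred, hv.dia_bot]; exact bot_le.trans_lt hc⟩
    (fun δ₁ h₁ δ₂ h₂ => ⟨or δ₁ δ₂, (hv.dia_or _ _).trans_lt (sup_lt_iff.2 ⟨h₁, h₂⟩),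
      .imp_self _ _⟩)
    (fun δ hδ h => absurd ((le_inf h le_rfl).trans (hv.dia_mp _ _)) (not_le.2 hδ))
  have hNe : (nhdsWithin (v (dia φ)) (Set.Iio (v (dia φ)))).NeBot :=
    nhdsLT_neBot_of_exists_lt ⟨c, hc⟩
  have hev : ∀ x : unitInterval, x < v (dia φ) →
      ∀ᶠ s in nhdsWithin (v (dia φ)) (Set.Iio (v (dia φ))), x < s := fun x hx =>
    nhdsWithin_le_nhds (Ioi_mem_nhds hx)
  obtain ⟨s, hsF, hsc, hs⟩ := (((Finset.eventually_all F).2 fun a _ =>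
    (Filter.eventually_imp_distrib_left.2 (hev (v (box a))))).and
      ((hev c hc).and self_mem_nhdsWithin)).exists
  obtain ⟨w, hw, hw1, -, hw3⟩ := hv.exists_glue hQ (H := Set.Ici (v (dia φ))) (isUpperSet_Ici _)
    (fun a ha => hSQ (ha.trans (hv.box_mono (.goedel (.k _ _)))))
    (fun a ha => Set.mem_Ici.2 (not_lt.1 fun hcon => hΔ a hcon ha))
    F (fun a _ h => le_trans (le_of_lt hs) h) (fun a ha h => hsF a ha (not_le.1 h))
    (bot_le.trans_lt hsc)
  refine ⟨w, s, hw, ?_, hsc, hw3⟩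
  have hφ : φ ∈ Q := hSQ (le_top.trans (hv.box_thm (.imp_self _ _)).ge)
  rw [hw1 φ hφ]
  exact hc.trans_le le_top

/-! ### Countability -/

/-- An injective numbering of the formulas over an encodable set of variables. -/
def Formula.code [Encodable Var] : Formula Var → ℕ
  | .var p => Nat.pair 0 (Encodable.encode p)
  | .bot => Nat.pair 1 0
  | .and φ ψ => Nat.pair 2 (Nat.pair φ.code ψ.code)
  | .or φ ψ => Nat.pair 3 (Nat.pair φ.code ψ.code)
  | .imp φ ψ => Nat.pair 4 (Nat.pair φ.code ψ.code)
  | .box φ => Nat.pair 5 φ.code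
  | .dia φ => Nat.pair 6 φ.code

theorem Formula.code_injective [Encodable Var] :
    Function.Injective (Formula.code : Formula Var → ℕ) := by
  intro φ
  induction φ with
  | var p => intro ψ h; cases ψ <;> simp_all [code]
  | bot => intro ψ h; cases ψ <;> simp_all [code]
  | and a b iha ihb =>
    intro ψ h
    cases ψ <;> simp [code] at h
    exact congrArg₂ _ (iha h.1) (ihb h.2)
  | or a b iha ihb =>
    intro ψ h
    cases ψ <;> simp [code] at h
    exact congrArg₂ _ (iha h.1) (ihb h.2)
  | imp a b iha ihb =>
    intro ψ h
    cases ψ <;> simp [code] at h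
    exact congrArg₂ _ (iha h.1) (ihb h.2)
  | box a iha =>
    intro ψ h
    cases ψ <;> simp [code] at h
    exact congrArg _ (iha h)
  | dia a iha =>
    intro ψ h
    cases ψ <;> simp [code] at h
    exact congrArg _ (iha h)

instance [Countable Var] : Countable (Formula Var) :=
  have : Encodable Var := Encodable.ofCountable _
  Formula.code_injective.countable

theorem exists_countable_closed {X ι : Type*} [Countable ι] (f : ι → X → X → X) (x₀ : X) :
    ∃ S : Set X, S.Countable ∧ x₀ ∈ S ∧ ∀ i, ∀ x ∈ S, ∀ y ∈ S, f i x y ∈ S := by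
  let A : ℕ → Set X := fun n => Nat.rec {x₀} (fun _ B => B ∪ ⋃ i, Set.image2 (f i) B B) n
  have hsucc : ∀ n, A (n + 1) = A n ∪ ⋃ i, Set.image2 (f i) (A n) (A n) := fun _ => rfl
  have hmono : Monotone A := monotone_nat_of_le_succ fun n => Set.subset_union_left
  have hcount : ∀ n, (A n).Countable := by
    intro n
    induction n with
    | zero => exact Set.countable_singleton x₀
    | succ n ih =>
      rw [hsucc]
      exact ih.union (Set.countable_iUnion fun i => ih.image2 ih _)
  refine ⟨⋃ n, A n, Set.countable_iUnion hcount, Set.mem_iUnion.2 ⟨0, rfl⟩, ?_⟩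
  intro i x hx y hy
  obtain ⟨m, hm⟩ := Set.mem_iUnion.1 hx
  obtain ⟨n, hn⟩ := Set.mem_iUnion.1 hy
  refine Set.mem_iUnion.2 ⟨max m n + 1, ?_⟩
  rw [hsucc]
  exact Or.inr (Set.mem_iUnion.2 ⟨i, Set.mem_image2_of_mem (hmono (le_max_left m n) hm)
    (hmono (le_max_right m n) hn)⟩)

/-- A countable dense bounded subchain embeds in `[0, 1]` with dense image. -/
theorem exists_strictMonoOn_dense {C : Type*} [LinearOrder C] [BoundedOrder C] [Nontrivial C]
    {A : Set C} (hA : A.Countable) (hbot : ⊥ ∈ A) (htop : ⊤ ∈ A)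
    (hdense : ∀ a ∈ A, ∀ b ∈ A, a < b → ∃ c ∈ A, a < c ∧ c < b) :
    ∃ j : C → unitInterval, StrictMonoOn j A ∧ j ⊥ = ⊥ ∧ j ⊤ = ⊤ ∧
      ∀ x y, x < y → ∃ a ∈ A, x < j a ∧ j a < y := by
  classical
  let B : Set C := {a | a ∈ A ∧ ⊥ < a ∧ a < ⊤}
  have : Countable B := (hA.mono fun a ha => ha.1).to_subtype
  have : Nonempty B := by
    obtain ⟨c, hc, h⟩ := hdense _ hbot _ htop bot_lt_top
    exact ⟨⟨c, hc, h⟩⟩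
  have : DenselyOrdered B := ⟨fun a b hab => by
    obtain ⟨c, hc, h⟩ := hdense _ a.2.1 _ b.2.1 hab
    exact ⟨⟨c, hc, a.2.2.1.trans h.1, h.2.trans b.2.2.2⟩, h.1, h.2⟩⟩
  have : NoMinOrder B := ⟨fun a => by
    obtain ⟨c, hc, h⟩ := hdense _ hbot _ a.2.1 a.2.2.1
    exact ⟨⟨c, hc, h.1, h.2.trans a.2.2.2⟩, h.2⟩⟩
  have : NoMaxOrder B := ⟨fun a => by
    obtain ⟨c, hc, h⟩ := hdense _ a.2.1 _ htop a.2.2.2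
    exact ⟨⟨c, hc, a.2.2.1.trans h.1, h.2⟩, h.1⟩⟩
  have : Nonempty (Set.Ioo (0 : ℚ) 1) := ⟨⟨1 / 2, by norm_num, by norm_num⟩⟩
  obtain ⟨e⟩ := Order.iso_of_countable_dense B (Set.Ioo (0 : ℚ) 1)
  have he0 : ∀ b, (0 : ℝ) < ((e b : ℚ) : ℝ) := fun b => by exact_mod_cast (e b).2.1
  have he1 : ∀ b, ((e b : ℚ) : ℝ) < 1 := fun b => by exact_mod_cast (e b).2.2
  -- Off `A` the value is a default and plays no role.
  let j : C → unitInterval := fun c =>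
    if h : c ∈ B then ⟨((e ⟨c, h⟩ : ℚ) : ℝ), (he0 _).le, (he1 _).le⟩ else if c = ⊤ then ⊤ else ⊥
  have hjbot : j ⊥ = ⊥ := by simp [j, B]
  have hjtop : j ⊤ = ⊤ := by simp [j, B]
  have hjB : ∀ c (h : c ∈ B), (j c : ℝ) = ((e ⟨c, h⟩ : ℚ) : ℝ) := fun c h => by simp [j, h]
  have hpos : ∀ c ∈ B, ⊥ < j c := fun c h => by
    rw [← Subtype.coe_lt_coe, hjB c h]; exact he0 _
  have hlt : ∀ c ∈ B, j c < ⊤ := fun c h => by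
    rw [← Subtype.coe_lt_coe, hjB c h]; exact he1 _
  refine ⟨j, ?_, hjbot, hjtop, ?_⟩
  · intro a ha b hb hab
    rcases eq_bot_or_bot_lt a with rfl | ha'
    · rw [hjbot]
      rcases eq_top_or_lt_top b with rfl | hb'
      · rw [hjtop]; exact bot_lt_top
      · exact hpos b ⟨hb, hab, hb'⟩
    · have haB : a ∈ B := ⟨ha, ha', hab.trans_le le_top⟩
      rcases eq_top_or_lt_top b with rfl | hb'
      · rw [hjtop]; exact hlt a haB
      · have hbB : b ∈ B := ⟨hb, ha'.trans hab, hb'⟩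
        rw [← Subtype.coe_lt_coe, hjB a haB, hjB b hbB, Rat.cast_lt, Subtype.coe_lt_coe,
          e.lt_iff_lt]
        exact hab
  · intro x y hxy
    obtain ⟨q, hq1, hq2⟩ := exists_rat_btwn (show (x : ℝ) < y from hxy)
    have hq : q ∈ Set.Ioo (0 : ℚ) 1 :=
      ⟨by exact_mod_cast x.2.1.trans_lt hq1, by exact_mod_cast hq2.trans_le y.2.2⟩
    refine ⟨e.symm ⟨q, hq⟩, (e.symm ⟨q, hq⟩).2.1, ?_, ?_⟩
    · rw [← Subtype.coe_lt_coe, hjB _ (e.symm ⟨q, hq⟩).2]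
      simpa using hq1
    · rw [← Subtype.coe_lt_coe, hjB _ (e.symm ⟨q, hq⟩).2]
      simpa using hq2

/-! ### The canonical model of a witnessed family of valuations -/

/-- `s` is a lower bound for the degree of accessibility of `w` from `v`. -/
def Compat {C : Type*} [LinearOrder C] (s : C) (v w : Formula Var → C) : Prop :=
  ∀ a, s ⊓ v (box a) ≤ w a ∧ s ⊓ w a ≤ v (dia a)

/-- A family of valuations in which every value of a modal formula can be approximated by the
values at other members of the family. -/
structure IsWitnessed {ι C : Type*} [LinearOrder C] (x : ι → Formula Var → C) : Prop where
  box (i : ι) (a : Formula Var) (c : C) : x i (box a) < c →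
    ∃ k s, x k a < c ∧ x k a < s ∧ Compat s (x i) (x k)
  dia (i : ι) (a : Formula Var) (c : C) : c < x i (dia a) →
    ∃ k s, c < x k a ∧ c < s ∧ Compat s (x i) (x k)

/-- The Gödel–Kripke model on a family of valuations. -/
noncomputable def canonicalModel {ι : Type v} [Nonempty ι]
    (x : ι → Formula Var → unitInterval) : GKModel.{u, v} Var where
  World := ι
  nonempty := inferInstance
  rel i k := ⨅ a, (x i (box a) ⇨ x k a) ⊓ (x k a ⇨ x i (dia a))
  val i p := x i (var p)

theorem compat_canonicalModel_rel {ι : Type v} [Nonempty ι]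
    (x : ι → Formula Var → unitInterval) (i k : ι) :
    Compat ((canonicalModel x).rel i k) (x i) (x k) := fun a =>
  have h := iInf_le (fun a => (x i (box a) ⇨ x k a) ⊓ (x k a ⇨ x i (dia a))) a
  ⟨le_himp_iff.1 (h.trans inf_le_left), le_himp_iff.1 (h.trans inf_le_right)⟩

theorem Compat.le_canonicalModel_rel {ι : Type v} [Nonempty ι]
    {x : ι → Formula Var → unitInterval} {i k : ι} {s : unitInterval}
    (h : Compat s (x i) (x k)) : s ≤ (canonicalModel x).rel i k :=
  le_iInf fun a => le_inf (le_himp_iff.2 (h a).1) (le_himp_iff.2 (h a).2)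

/-- The bounds `Compat` give one half of each modal case. For the other half, the witness has degree
at least `s`: for `□` this exceeds the value of `a`, so the Gödel implication returns that value and
not `1`; for `◇` it exceeds `c`. -/
theorem eval_canonicalModel {ι : Type v} [Nonempty ι] {x : ι → Formula Var → unitInterval}
    (hx : ∀ i, IsVal (x i)) (hw : IsWitnessed x) (φ : Formula Var) :
    ∀ i : ι, (canonicalModel x).eval i φ = x i φ := by
  induction φ with
  | var p => exact fun i => rfl
  | bot => exact fun i => (hx i).map_bot.symm
  | and a b iha ihb => exact fun i => by rw [(hx i).map_and, ← iha i, ← ihb i]; rfl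
  | or a b iha ihb => exact fun i => by rw [(hx i).map_or, ← iha i, ← ihb i]; rfl
  | imp a b iha ihb =>
    intro i
    change (canonicalModel x).eval i a ⇨ (canonicalModel x).eval i b = _
    rw [iha, ihb]
    exact eq_of_forall_le_iff fun c => le_himp_iff.trans (hx i).le_imp_iff.symm
  | box a iha =>
    intro i
    change ⨅ k : ι, ((canonicalModel x).rel i k ⇨ (canonicalModel x).eval k a) = _
    simp only [iha]
    refine le_antisymm (le_of_forall_gt fun c hc => ?_) (le_iInf fun k => ?_)
    · obtain ⟨k, s, h1, h2, h3⟩ := hw.box i a c hc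
      refine (iInf_le _ k).trans_lt ?_
      rw [himp_unitInterval, if_neg (not_le.2 (h2.trans_le h3.le_canonicalModel_rel))]
      exact h1
    · rw [le_himp_iff, inf_comm]
      exact (compat_canonicalModel_rel x i k a).1
  | dia a iha =>
    intro i
    change ⨆ k : ι, ((canonicalModel x).rel i k ⊓ (canonicalModel x).eval k a) = _
    simp only [iha]
    refine le_antisymm (iSup_le fun k => (compat_canonicalModel_rel x i k a).2)
      (le_of_forall_lt fun c hc => ?_)
    obtain ⟨k, s, h1, h2, h3⟩ := hw.dia i a c hc
    exact (lt_inf_iff.2 ⟨h2.trans_le h3.le_canonicalModel_rel, h1⟩).trans_le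
      (le_iSup (fun k => (canonicalModel x).rel i k ⊓ x k a) k)

/-! ### The ultrapower -/

theorem IsVal.comp {C D : Type*} [LinearOrder C] [BoundedOrder C] [LinearOrder D]
    [BoundedOrder D] {v : Formula Var → C} (hv : IsVal v) {A : Set C} (hA : ∀ a, v a ∈ A)
    {j : C → D} (hj : StrictMonoOn j A) (hbot : j ⊥ = ⊥) (htop : j ⊤ = ⊤) :
    IsVal fun a => j (v a) where
  map_bot := by rw [hv.map_bot, hbot]
  map_and a b := by
    rcases le_total (v a) (v b) with h | h
    · rw [hv.map_and, inf_eq_left.2 h, inf_eq_left.2 ((hj.le_iff_le (hA a) (hA b)).2 h)]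
    · rw [hv.map_and, inf_eq_right.2 h, inf_eq_right.2 ((hj.le_iff_le (hA b) (hA a)).2 h)]
  map_or a b := by
    rcases le_total (v a) (v b) with h | h
    · rw [hv.map_or, sup_eq_right.2 h, sup_eq_right.2 ((hj.le_iff_le (hA a) (hA b)).2 h)]
    · rw [hv.map_or, sup_eq_left.2 h, sup_eq_left.2 ((hj.le_iff_le (hA b) (hA a)).2 h)]
  imp_of_le h := by rw [hv.imp_of_le ((hj.le_iff_le (hA _) (hA _)).1 h), htop]
  imp_of_lt h := by rw [hv.imp_of_lt ((hj.lt_iff_lt (hA _) (hA _)).1 h)]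
  thm h := by rw [hv.thm h, htop]

theorem Compat.comp {C D : Type*} [LinearOrder C] [LinearOrder D] {s : C}
    {v w : Formula Var → C} (h : Compat s v w) {A : Set C} (hs : s ∈ A) (hv : ∀ a, v a ∈ A)
    (hw : ∀ a, w a ∈ A) {j : C → D} (hj : StrictMonoOn j A) :
    Compat (j s) (fun a => j (v a)) fun a => j (w a) := fun a => by
  constructor
  · rw [inf_le_iff, hj.le_iff_le hs (hw a), hj.le_iff_le (hv _) (hw a), ← inf_le_iff]
    exact (h a).1
  · rw [inf_le_iff, hj.le_iff_le hs (hv _), hj.le_iff_le (hw a) (hv _), ← inf_le_iff]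
    exact (h a).2

/-- The ultrapower of the unit interval. -/
abbrev HyperInterval : Type :=
  Filter.Germ ((Filter.hyperfilter ℕ : Ultrafilter ℕ) : Filter ℕ) unitInterval

/-- Sequences of valuations, which are valuations in the ultrapower. -/
def ValSeq (Var : Type u) : Type u :=
  {v : ℕ → Formula Var → unitInterval // ∀ n, IsVal (v n)}

/-- The value of a formula in the ultrapower. -/
noncomputable def ValSeq.ev (v : ValSeq Var) (a : Formula Var) : HyperInterval :=
  ((fun n => v.1 n a : ℕ → unitInterval) : HyperInterval)

/-- An instance of Łoś's theorem; an ultrafilter makes the order total, so each case distinction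
holds at almost all indices. -/
theorem ValSeq.isVal_ev (v : ValSeq Var) : IsVal v.ev where
  map_bot := Filter.Germ.coe_eq.2 (.of_forall fun n => (v.2 n).map_bot)
  map_and a b := by
    rcases le_total (v.ev a) (v.ev b) with h | h
    · rw [inf_eq_left.2 h]
      refine Filter.Germ.coe_eq.2 ((Filter.Germ.coe_le.1 h).mono fun n hn => ?_)
      exact ((v.2 n).map_and a b).trans (inf_eq_left.2 hn)
    · rw [inf_eq_right.2 h]
      refine Filter.Germ.coe_eq.2 ((Filter.Germ.coe_le.1 h).mono fun n hn => ?_)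
      exact ((v.2 n).map_and a b).trans (inf_eq_right.2 hn)
  map_or a b := by
    rcases le_total (v.ev a) (v.ev b) with h | h
    · rw [sup_eq_right.2 h]
      refine Filter.Germ.coe_eq.2 ((Filter.Germ.coe_le.1 h).mono fun n hn => ?_)
      exact ((v.2 n).map_or a b).trans (sup_eq_right.2 hn)
    · rw [sup_eq_left.2 h]
      refine Filter.Germ.coe_eq.2 ((Filter.Germ.coe_le.1 h).mono fun n hn => ?_)
      exact ((v.2 n).map_or a b).trans (sup_eq_left.2 hn)
  imp_of_le h := Filter.Germ.coe_eq.2 ((Filter.Germ.coe_le.1 h).mono fun n hn =>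
    (v.2 n).imp_of_le hn)
  imp_of_lt h := Filter.Germ.coe_eq.2 ((Filter.Germ.coe_lt.1 h).mono fun n hn =>
    (v.2 n).imp_of_lt hn)
  thm h := Filter.Germ.coe_eq.2 (.of_forall fun n => (v.2 n).thm h)

theorem HyperInterval.exists_between {a b : HyperInterval} (h : a < b) :
    ∃ c, a < c ∧ c < b := by
  induction a using Filter.Germ.inductionOn with | _ f
  induction b using Filter.Germ.inductionOn with | _ g
  have h' := Filter.Germ.coe_lt.1 h
  choose! k hk using fun n (hn : f n < g n) => _root_.exists_between hn
  exact ⟨(k : HyperInterval), Filter.Germ.coe_lt.2 (h'.mono fun n hn => (hk n hn).1),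
    Filter.Germ.coe_lt.2 (h'.mono fun n hn => (hk n hn).2)⟩

theorem Formula.exists_finset_seq (Var : Type u) [Countable Var] :
    ∃ F : ℕ → Finset (Formula Var), ∀ a, ∀ᶠ n in Filter.atTop, a ∈ F n := by
  have : Encodable Var := Encodable.ofCountable _
  refine ⟨fun n => ((Set.finite_Iic n).preimage code_injective.injOn).toFinset, fun a => ?_⟩
  filter_upwards [Filter.eventually_ge_atTop a.code] with n hn
  simpa using hn

theorem ValSeq.compat_of_finset {F : ℕ → Finset (Formula Var)}
    (hF : ∀ a, ∀ᶠ n in Filter.atTop, a ∈ F n) {v w : ValSeq Var} {s : ℕ → unitInterval}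
    (h : ∀ᶠ n in (Filter.hyperfilter ℕ : Filter ℕ), ∀ a ∈ F n,
      s n ⊓ v.1 n (box a) ≤ w.1 n a ∧ s n ⊓ w.1 n a ≤ v.1 n (dia a)) :
    Compat (s : HyperInterval) v.ev w.ev := by
  intro a
  have ha : ∀ᶠ n in (Filter.hyperfilter ℕ : Filter ℕ), a ∈ F n :=
    (hF a).filter_mono Nat.hyperfilter_le_atTop
  constructor
  · rw [inf_le_iff]
    rcases le_total (s : HyperInterval) (v.ev (box a)) with h1 | h1
    · refine Or.inl (Filter.Germ.coe_le.2 ?_)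
      filter_upwards [h, ha, Filter.Germ.coe_le.1 h1] with n hn han h1n
      exact (inf_eq_left.2 h1n).ge.trans (hn a han).1
    · refine Or.inr (Filter.Germ.coe_le.2 ?_)
      filter_upwards [h, ha, Filter.Germ.coe_le.1 h1] with n hn han h1n
      exact (inf_eq_right.2 h1n).ge.trans (hn a han).1
  · rw [inf_le_iff]
    rcases le_total (s : HyperInterval) (w.ev a) with h1 | h1
    · refine Or.inl (Filter.Germ.coe_le.2 ?_)
      filter_upwards [h, ha, Filter.Germ.coe_le.1 h1] with n hn han h1n
      exact (inf_eq_left.2 h1n).ge.trans (hn a han).2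
    · refine Or.inr (Filter.Germ.coe_le.2 ?_)
      filter_upwards [h, ha, Filter.Germ.coe_le.1 h1] with n hn han h1n
      exact (inf_eq_right.2 h1n).ge.trans (hn a han).2

/-- At index `n` the witness respects the fragment `F n`. Each formula lies in almost all fragments,
so the sequence of witnesses respects all formulas. -/
theorem ValSeq.isWitnessed [Countable Var] : IsWitnessed (ValSeq.ev (Var := Var)) := by
  obtain ⟨F, hF⟩ := Formula.exists_finset_seq Var
  constructor
  · intro v a c hc
    induction c using Filter.Germ.inductionOn with | _ c
    have hc' := Filter.Germ.coe_lt.1 hc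
    have : ∀ n, ∃ (w : Formula Var → unitInterval) (s : unitInterval), IsVal w ∧
        (v.1 n (box a) < c n → w a < c n ∧ w a < s ∧
          ∀ b ∈ F n, s ⊓ v.1 n (box b) ≤ w b ∧ s ⊓ w b ≤ v.1 n (dia b)) := fun n => by
      by_cases hn : v.1 n (box a) < c n
      · obtain ⟨w, s, hw, h⟩ := (v.2 n).exists_box_witness hn (F n)
        exact ⟨w, s, hw, fun _ => h⟩
      -- A default at indices outside the ultrafilter set where the inequality holds.
      · exact ⟨v.1 n, 0, v.2 n, fun h => absurd h hn⟩
    choose w s hw h using this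
    exact ⟨⟨w, hw⟩, (s : HyperInterval), Filter.Germ.coe_lt.2 (hc'.mono fun n hn => (h n hn).1),
      Filter.Germ.coe_lt.2 (hc'.mono fun n hn => (h n hn).2.1),
      compat_of_finset hF (hc'.mono fun n hn => (h n hn).2.2)⟩
  · intro v a c hc
    induction c using Filter.Germ.inductionOn with | _ c
    have hc' := Filter.Germ.coe_lt.1 hc
    have : ∀ n, ∃ (w : Formula Var → unitInterval) (s : unitInterval), IsVal w ∧
        (c n < v.1 n (dia a) → c n < w a ∧ c n < s ∧
          ∀ b ∈ F n, s ⊓ v.1 n (box b) ≤ w b ∧ s ⊓ w b ≤ v.1 n (dia b)) := fun n => by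
      by_cases hn : c n < v.1 n (dia a)
      · obtain ⟨w, s, hw, h⟩ := (v.2 n).exists_dia_witness hn (F n)
        exact ⟨w, s, hw, fun _ => h⟩
      · exact ⟨v.1 n, 0, v.2 n, fun h => absurd h hn⟩
    choose w s hw h using this
    exact ⟨⟨w, hw⟩, (s : HyperInterval), Filter.Germ.coe_lt.2 (hc'.mono fun n hn => (h n hn).1),
      Filter.Germ.coe_lt.2 (hc'.mono fun n hn => (h n hn).2.1),
      compat_of_finset hF (hc'.mono fun n hn => (h n hn).2.2)⟩

/-- A countable witnessed family in `[0, 1]` with a member having the same true formulas as a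
given sequence of valuations in the ultrapower. -/
theorem ValSeq.exists_isWitnessed [Countable Var] (v₀ : ValSeq Var) :
    ∃ (ι : Type u) (x : ι → Formula Var → unitInterval) (i₀ : ι), (∀ i, IsVal (x i)) ∧
      IsWitnessed x ∧ ∀ a, x i₀ a = ⊤ ↔ v₀.ev a = ⊤ := by
  have : Nonempty (ValSeq Var) := ⟨v₀⟩
  have hwit := ValSeq.isWitnessed (Var := Var)
  choose! kb sb hb1 hb2 hb3 using hwit.box
  choose! kd sd hd1 hd2 hd3 using hwit.dia
  choose! m hm1 hm2 using fun (a b : HyperInterval) (h : a < b) => HyperInterval.exists_between h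
  let X := ValSeq Var × HyperInterval
  -- Pairs carry valuations and hyperreal values together. The operations add box witnesses, diamond
  -- witnesses, values of formulas, and intermediate points for density.
  obtain ⟨S, hS, h0, hcl⟩ := exists_countable_closed
    (ι := (Formula Var ⊕ Formula Var) ⊕ (Formula Var ⊕ Unit)) (X := X)
    (Sum.elim
      (Sum.elim (fun a p q => (kb p.1 a q.2, sb p.1 a q.2)) fun a p q =>
        (kd p.1 a q.2, sd p.1 a q.2))
      (Sum.elim (fun a p _ => (p.1, p.1.ev a)) fun _ p q => (p.1, m p.2 q.2)))
    (v₀, ⊥)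
  have hclb : ∀ a, ∀ p ∈ S, ∀ q ∈ S, ((kb p.1 a q.2, sb p.1 a q.2) : X) ∈ S := fun a =>
    hcl (.inl (.inl a))
  have hcld : ∀ a, ∀ p ∈ S, ∀ q ∈ S, ((kd p.1 a q.2, sd p.1 a q.2) : X) ∈ S := fun a =>
    hcl (.inl (.inr a))
  have hcle : ∀ a, ∀ p ∈ S, ((p.1, p.1.ev a) : X) ∈ S := fun a p hp =>
    hcl (.inr (.inl a)) p hp p hp
  have hclm : ∀ p ∈ S, ∀ q ∈ S, ((p.1, m p.2 q.2) : X) ∈ S := hcl (.inr (.inr ()))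
  let A : Set HyperInterval := Prod.snd '' S
  have hev : ∀ p ∈ S, ∀ a, p.1.ev a ∈ A := fun p hp a => ⟨_, hcle a p hp, rfl⟩
  have htopA : ⊤ ∈ A := by
    have := hev _ h0 (imp bot bot)
    rwa [v₀.isVal_ev.thm (.imp_self _ _)] at this
  obtain ⟨j, hj, hjb, hjt, hjd⟩ := exists_strictMonoOn_dense (A := A) (hS.image _)
    ⟨_, h0, rfl⟩ htopA (by
      rintro _ ⟨p, hp, rfl⟩ _ ⟨q, hq, rfl⟩ hpq
      exact ⟨_, ⟨_, hclm p hp q hq, rfl⟩, hm1 _ _ hpq, hm2 _ _ hpq⟩)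
  refine ⟨S, fun p a => j (p.1.1.ev a), ⟨_, h0⟩,
    fun p => p.1.1.isVal_ev.comp (hev _ p.2) hj hjb hjt, ⟨?_, ?_⟩, fun a => ?_⟩
  · rintro ⟨p, hp⟩ a c hc
    -- The bound `c` need not be a value of `j`; density of the image replaces it by the image of
    -- some `q.2` in `A`, for which a witness was adjoined.
    obtain ⟨_, ⟨q, hq, rfl⟩, hq1, hq2⟩ := hjd _ _ hc
    have hpq := (hj.lt_iff_lt (hev p hp _) ⟨q, hq, rfl⟩).1 hq1
    have hk := hclb a p hp q hq
    have hs : sb p.1 a q.2 ∈ A := ⟨_, hk, rfl⟩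
    refine ⟨⟨_, hk⟩, j (sb p.1 a q.2), ?_, ?_, ?_⟩
    · exact (hj (hev _ hk a) ⟨q, hq, rfl⟩ (hb1 _ _ _ hpq)).trans hq2
    · exact hj (hev _ hk a) hs (hb2 _ _ _ hpq)
    · exact (hb3 _ _ _ hpq).comp hs (hev _ hp) (hev _ hk) hj
  · rintro ⟨p, hp⟩ a c hc
    obtain ⟨_, ⟨q, hq, rfl⟩, hq1, hq2⟩ := hjd _ _ hc
    have hpq := (hj.lt_iff_lt ⟨q, hq, rfl⟩ (hev p hp _)).1 hq2
    have hk := hcld a p hp q hq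
    have hs : sd p.1 a q.2 ∈ A := ⟨_, hk, rfl⟩
    refine ⟨⟨_, hk⟩, j (sd p.1 a q.2), ?_, ?_, ?_⟩
    · exact hq1.trans (hj ⟨q, hq, rfl⟩ (hev _ hk a) (hd1 _ _ _ hpq))
    · exact hq1.trans (hj ⟨q, hq, rfl⟩ hs (hd2 _ _ _ hpq))
    · exact (hd3 _ _ _ hpq).comp hs (hev _ hp) (hev _ hk) hj
  · change j (v₀.ev a) = ⊤ ↔ _
    rw [← hjt]
    exact hj.injOn.eq_iff (hev _ h0 a) htopA

/-! ### Strong completeness -/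

theorem exists_countermodel [Countable Var] {T : Set (Formula Var)} {φ : Formula Var}
    (h : ¬ Derives T φ) : ∃ (M : GKModel.{u, u} Var) (x : M.World),
      (∀ θ ∈ T, M.TrueAt x θ) ∧ ¬ M.TrueAt x φ := by
  obtain ⟨Q, hQ, hTQ, hφ⟩ := (isTheory_derives T).exists_prime (Δ := {φ}) ⟨φ, rfl⟩
    (by
      rintro _ rfl _ rfl
      exact ⟨_, rfl, .or_elim (.imp_self _ _) (.imp_self _ _)⟩)
    (by rintro _ rfl; exact h)
  obtain ⟨v, hv, hvQ⟩ := hQ.exists_isVal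
  obtain ⟨ι, x, i₀, hx, hw, hi₀⟩ := ValSeq.exists_isWitnessed ⟨fun _ => v, fun _ => hv⟩
  have : Nonempty ι := ⟨i₀⟩
  have key : ∀ a, (canonicalModel x).TrueAt i₀ a ↔ a ∈ Q := fun a => by
    unfold GKModel.TrueAt
    rw [eval_canonicalModel hx hw, ← hvQ]
    refine (hi₀ a).trans (Filter.Germ.coe_eq.trans ?_)
    exact Filter.eventually_const (p := v a = 1) (f := (Filter.hyperfilter ℕ : Filter ℕ))
  exact ⟨canonicalModel x, i₀, fun θ hθ => (key θ).2 (hTQ (.hyp hθ)),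
    fun hc => hφ φ rfl ((key φ).1 hc)⟩

/-! ### Reduction to countably many variables -/

/-- Substitution of formulas for variables. -/
def Formula.subst {Var' : Type v} (σ : Var → Formula Var') : Formula Var → Formula Var'
  | .var p => σ p
  | .bot => .bot
  | .and φ ψ => .and (φ.subst σ) (ψ.subst σ)
  | .or φ ψ => .or (φ.subst σ) (ψ.subst σ)
  | .imp φ ψ => .imp (φ.subst σ) (ψ.subst σ)
  | .box φ => .box (φ.subst σ)
  | .dia φ => .dia (φ.subst σ)

/-- The variables occurring in a formula. -/
def Formula.vars : Formula Var → Set Var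
  | .var p => {p}
  | .bot => ∅
  | .and φ ψ => φ.vars ∪ ψ.vars
  | .or φ ψ => φ.vars ∪ ψ.vars
  | .imp φ ψ => φ.vars ∪ ψ.vars
  | .box φ => φ.vars
  | .dia φ => φ.vars

theorem Formula.countable_vars (φ : Formula Var) : φ.vars.Countable := by
  induction φ with
  | var p => exact Set.countable_singleton p
  | bot => exact Set.countable_empty
  | and a b iha ihb => exact iha.union ihb
  | or a b iha ihb => exact iha.union ihb
  | imp a b iha ihb => exact iha.union ihb
  | box a iha => exact iha
  | dia a iha => exact iha

theorem Formula.subst_subst_eq {Var' : Type v} {σ : Var → Formula Var'}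
    {τ : Var' → Formula Var} (φ : Formula Var) (h : ∀ p ∈ φ.vars, (σ p).subst τ = .var p) :
    (φ.subst σ).subst τ = φ := by
  induction φ with
  | var p => exact h p rfl
  | bot => rfl
  | and a b iha ihb =>
    exact congrArg₂ _ (iha fun p hp => h p (.inl hp)) (ihb fun p hp => h p (.inr hp))
  | or a b iha ihb =>
    exact congrArg₂ _ (iha fun p hp => h p (.inl hp)) (ihb fun p hp => h p (.inr hp))
  | imp a b iha ihb =>
    exact congrArg₂ _ (iha fun p hp => h p (.inl hp)) (ihb fun p hp => h p (.inr hp))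
  | box a iha => exact congrArg _ (iha h)
  | dia a iha => exact congrArg _ (iha h)

theorem Derives.subst {Var' : Type v} (σ : Var → Formula Var') {T : Set (Formula Var)}
    {φ : Formula Var} (d : Derives T φ) : Derives (Formula.subst σ '' T) (φ.subst σ) := by
  induction d with
  | hyp h => exact .hyp ⟨_, h, rfl⟩
  | goedel h => exact .goedel (by cases h <;> constructor)
  | modal h => exact .modal (by cases h <;> constructor)
  | mp _ _ ih1 ih2 => exact .mp ih1 ih2
  | necBox _ ih => exact .necBox (by simpa using ih)
  | monoDia _ ih => exact .monoDia (by simpa [Formula.subst] using ih)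

/-- The model obtained by renaming variables and lifting the worlds to another universe. -/
def GKModel.rename {Var' : Type*} (M : GKModel.{_, 0} Var') (f : Var → Var') :
    GKModel.{u, v} Var where
  World := ULift.{v} M.World
  nonempty := ⟨⟨M.nonempty.some⟩⟩
  rel x y := M.rel x.down y.down
  val x p := M.val x.down (f p)

theorem GKModel.eval_rename {Var' : Type*} (M : GKModel.{_, 0} Var') (f : Var → Var')
    (φ : Formula Var) : ∀ x : M.World,
      (M.rename f : GKModel.{u, v} Var).eval ⟨x⟩ φ = M.eval x (φ.subst fun p => var (f p)) := by
  induction φ with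
  | var p => exact fun x => rfl
  | bot => exact fun x => rfl
  | and a b iha ihb => exact fun x => congrArg₂ _ (iha x) (ihb x)
  | or a b iha ihb => exact fun x => congrArg₂ _ (iha x) (ihb x)
  | imp a b iha ihb => exact fun x => congrArg₂ _ (iha x) (ihb x)
  | box a iha =>
    exact fun x => Equiv.ulift.iInf_congr fun y => congrArg (M.rel x y.down ⇨ ·) (iha y.down).symm
  | dia a iha =>
    exact fun x => Equiv.ulift.iSup_congr fun y => congrArg (M.rel x y.down ⊓ ·) (iha y.down).symm

/-- The occurring variables are renamed injectively into `ℕ`. Substituting back turns a derivation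
of the renamed formula into one of the original, while a countermodel over `ℕ` pulls back along the
renaming. -/
theorem Derives.of_entails {T : Set (Formula Var)} (hT : T.Countable) {φ : Formula Var}
    (h : Entails.{u, v} T φ) : Derives T φ := by
  classical
  let V : Set Var := ⋃ a ∈ insert φ T, a.vars
  have hV : V.Countable := (hT.insert φ).biUnion fun a _ => a.countable_vars
  have hmem : ∀ a ∈ insert φ T, a.vars ⊆ V := fun a ha => Set.subset_biUnion_of_mem ha
  obtain ⟨f, hf⟩ := Set.countable_iff_exists_injOn.1 hV
  -- A left inverse of the renaming on `V`; `bot` is an arbitrary value off its range.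
  let τ : ℕ → Formula Var := fun n => if h : ∃ p ∈ V, f p = n then var h.choose else bot
  have hτ : ∀ p ∈ V, τ (f p) = var p := fun p hp => by
    have hex : ∃ q ∈ V, f q = f p := ⟨p, hp, rfl⟩
    simp only [τ, dif_pos hex]
    exact congrArg var (hf hex.choose_spec.1 hp hex.choose_spec.2)
  have hinv : ∀ a ∈ insert φ T, (a.subst fun p => var (f p)).subst τ = a := fun a ha =>
    a.subst_subst_eq fun p hp => hτ p (hmem a ha hp)
  by_contra hcon
  have hnot : ¬ Derives (Formula.subst (fun p => var (f p)) '' T)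
      (φ.subst fun p => var (f p)) := fun d => by
    have d' := d.subst τ
    rw [hinv φ (Set.mem_insert _ _), Set.image_image] at d'
    refine hcon (d'.mono ?_)
    rintro _ ⟨a, ha, rfl⟩
    simpa only [hinv a (Set.mem_insert_of_mem _ ha)] using ha
  obtain ⟨M, x, hMT, hMφ⟩ := exists_countermodel hnot
  refine hMφ ((M.eval_rename f φ x).symm.trans (h (M.rename f) ⟨x⟩ fun θ hθ => ?_))
  exact (M.eval_rename f θ x).trans (hMT _ ⟨θ, hθ, rfl⟩)

end BiModalGoedel

theorem mainTheorem1 {Var : Type u} (T : Set (BiModalGoedel.Formula Var)) (hT : T.Countable)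
    (φ : BiModalGoedel.Formula Var) :
    BiModalGoedel.Derives T φ ↔ BiModalGoedel.Entails.{u, v} T φ :=
  ⟨fun d => d.sound, fun h => .of_entails hT h⟩
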